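/- **Theorem.** Let $n,k\ge 1$ be integers, and let $\searrow_n = n\cdots 1$ be the decreasing permutation of size $n$. Then $$P_k^{\mathrm{Av}(\searrow_n)}=\Pi\bigl(P(\mathcal{O}v^{\mathfrak C}(k,\searrow_n))\bigr),$$ where the notation is as follows. *Patterns and the feasible region.* $\mathcal S_k$ is the set of permutations of size $k$ (with $\mathcal S_0$ consisting of the empty permutation). For $\sigma\in\mathcal S_N$ and indices $I=\{i_1<\dots<i_j\}\subseteq\{1,\dots,N\}$, $\mathrm{pat}_I(\sigma)\in\mathcal S_j$ is the permutation whose entries are in the same relative order as $\sigma(i_1),\dots,\sigma(i_j)$; $\mathrm{beg}_j$ and $\mathrm{end}_j$ denote $\mathrm{pat}_I$ for $I$ the first, respectively the last, $j$ indices. $\mathrm{Av}_N(\searrow_n)$ is the set of $\sigma\in\mathcal S_N$ such that $\mathrm{pat}_I(\sigma)\ne\searrow_n$ for all $I$, and $\mathrm{Av}(\searrow_n)=\bigcup_{N\ge1}\mathrm{Av}_N(\searrow_n)$. For $\pi\in\mathcal S_k$ and $\sigma\in\mathcal S_N$ let $\widetilde{\mathrm{c\text{-}occ}}(\pi,\sigma)$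 be $\frac1N$ times the number of intervals $I\subseteq\{1,\dots,N\}$ with $\mathrm{pat}_I(\sigma)=\pi$. The region $P_k^{\mathrm{Av}(\searrow_n)}$ is the set of $\vec v\in[0,1]^{\mathcal S_k}$ for which there is a sequence $(\sigma^m)_{m\ge1}$ in $\mathrm{Av}(\searrow_n)$ with $|\sigma^m|\to\infty$ and $\widetilde{\mathrm{c\text{-}occ}}(\pi,\sigma^m)\to\vec v_\pi$ for all $\pi\in\mathcal S_k$. *Colourings.* An $m$-colouring of a permutation of size $k$ is a map $\{1,\dots,k\}\to\{1,\dots,m\}$ from its indices to colours. The RITMO colouring of $\sigma$ treats the values of $\sigma$ from the highest to the lowest, and gives each one the lowest colour in $\{1,2,\dots\}$ that creates no monochromatic pattern $21$ with the values already coloured. Restricting a coloured permutation to a set of indices $I$ restricts the colouring along with the permutation. For $\pi\in\mathrm{Av}_k(\searrow_n)$, an $m$-colouring $\mathfrak c$ of $\pi$ is *inherited* if there are $\ell\ge k$ and $\sigma\in\mathrm{Av}_\ell(\searrow_n)$ such that $\mathrm{end}_k$ of $\sigma$ with its RITMO colouring is $(\pi,\mathfrak c)$. Let $\mathcal C_{n-1}(k)$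 be the set of pairs $(\pi,\mathfrak c)$ with $\pi\in\mathrm{Av}_k(\searrow_n)$ and $\mathfrak c$ an inherited $(n-1)$-colouring of $\pi$. *The graph.* The coloured overlap graph $\mathcal{O}v^{\mathfrak C}(k,\searrow_n)$ is the directed multigraph with vertex set $\mathcal C_{n-1}(k-1)$ and edge set $\mathcal C_{n-1}(k)$, in which the edge $(\pi,\mathfrak c)$ goes from $\mathrm{beg}_{k-1}(\pi,\mathfrak c)$ to $\mathrm{end}_{k-1}(\pi,\mathfrak c)$. *The cycle polytope.* For a directed multigraph $G=(V,E)$, a simple cycle is a non-empty closed walk $\mathcal C$ whose edges are distinct and whose vertices are distinct except that the first one equals the last one. Let $\vec e_{\mathcal C}\in\mathbb R^E$ be the vector whose coordinate at $e$ is the number of occurrences of $e$ in $\mathcal C$ divided by the number of edges of $\mathcal C$. Then $P(G)$ is the convex hull of the vectors $\vec e_{\mathcal C}$ over all simple cycles $\mathcal C$ of $G$. *The projection.* $\Pi:\mathbb R^{\mathcal C_{n-1}(k)}\to\mathbb R^{\mathrm{Av}_k(\searrow_n)}$ is the linear map that sends the basis vector of $(\pi,\mathfrak c)$ to the basis vector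 of $\pi$. The space $\mathbb R^{\mathrm{Av}_k(\searrow_n)}$ is regarded as a subspace of $\mathbb R^{\mathcal S_k}$ by setting the coordinates outside $\mathrm{Av}_k(\searrow_n)$ to zero. -/

import Mathlib

open Filter Topology

namespace ConsecutivePatterns

/-! ### Permutations and patterns -/

/-- The standardization of a sequence `x_1, …, x_k` of distinct elements of a linear order: the
permutation whose entries are in the same relative order (see `std_lt_std_iff`). -/
def std {k : ℕ} {α : Type*} [LinearOrder α] (x : Fin k → α) : Equiv.Perm (Fin k) :=
  (Tuple.sort x)⁻¹

theorem std_lt_std_iff {k : ℕ} {α : Type*} [LinearOrder α] {x : Fin k → α}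
    (hx : Function.Injective x) (i j : Fin k) : std x i < std x j ↔ x i < x j := by
  have hm : StrictMono (x ∘ Tuple.sort x) :=
    (Tuple.monotone_sort x).strictMono_of_injective (hx.comp (Tuple.sort x).injective)
  have h := hm.lt_iff_lt (a := std x i) (b := std x j)
  simpa [std] using h.symm

/-- `pat I σ` is the pattern of `σ` induced by the set of indices `I = {i_1 < ⋯ < i_j}`; the set
is given by its increasing enumeration. -/
def pat {j N : ℕ} (I : Fin j ↪o Fin N) (σ : Equiv.Perm (Fin N)) : Equiv.Perm (Fin j) :=
  std fun a => σ (I a)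

theorem pat_lt_pat_iff {j N : ℕ} (I : Fin j ↪o Fin N) (σ : Equiv.Perm (Fin N)) (a b : Fin j) :
    pat I σ a < pat I σ b ↔ σ (I a) < σ (I b) :=
  std_lt_std_iff (σ.injective.comp I.injective) a b

theorem perm_eq_of_lt_iff {k : ℕ} {σ τ : Equiv.Perm (Fin k)}
    (h : ∀ a b, σ a < σ b ↔ τ a < τ b) : σ = τ := by
  have hm : StrictMono fun x => τ (σ.symm x) := fun x y hxy => by
    have := (h (σ.symm x) (σ.symm y)).1 (by simpa using hxy)
    exact this
  have h1 : Set.range (fun x => τ (σ.symm x)) = Set.range (id : Fin k → Fin k) := by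
    rw [Set.range_id]
    exact (σ.symm.trans τ).range_eq_univ
  have hid := (hm.range_inj strictMono_id).1 h1
  ext a
  have h2 := congrFun hid (σ a)
  simp only [Equiv.symm_apply_apply, id] at h2
  rw [h2]

theorem pat_pat {i j N : ℕ} (I : Fin i ↪o Fin j) (J : Fin j ↪o Fin N) (σ : Equiv.Perm (Fin N)) :
    pat I (pat J σ) = pat (I.trans J) σ :=
  perm_eq_of_lt_iff fun a b => by simp [pat_lt_pat_iff]

/-- The interval of `j` consecutive indices that follow the first `i` indices. -/
def window {j N : ℕ} (i : ℕ) (h : i + j ≤ N) : Fin j ↪o Fin N :=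
  OrderEmbedding.ofStrictMono (fun a => ⟨i + a, by omega⟩) fun a b hab => by
    have : (a : ℕ) < b := hab
    exact Fin.mk_lt_mk.2 (by omega)

/-- The first `j` indices. -/
def firstIdx {j N : ℕ} (h : j ≤ N) : Fin j ↪o Fin N := window 0 (by omega)

/-- The last `j` indices. -/
def lastIdx {j N : ℕ} (h : j ≤ N) : Fin j ↪o Fin N := window (N - j) (by omega)

theorem firstIdx_val {j N : ℕ} (h : j ≤ N) (a : Fin j) : (firstIdx h a : ℕ) = a :=
  Nat.zero_add _

theorem lastIdx_val {j N : ℕ} (h : j ≤ N) (a : Fin j) : (lastIdx h a : ℕ) = N - j + a :=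
  rfl

/-- `σ` contains an occurrence of `π`. -/
def Contains {j N : ℕ} (σ : Equiv.Perm (Fin N)) (π : Equiv.Perm (Fin j)) : Prop :=
  ∃ I : Fin j ↪o Fin N, pat I σ = π

/-- The number of consecutive occurrences of `π` in `σ`. -/
noncomputable def coc {j N : ℕ} (π : Equiv.Perm (Fin j)) (σ : Equiv.Perm (Fin N)) : ℕ :=
  Nat.card {i : Fin N // ∃ h : (i : ℕ) + j ≤ N, pat (window i h) σ = π}

/-- The proportion of consecutive occurrences of `π` in `σ`. -/
noncomputable def cocDensity {j N : ℕ} (π : Equiv.Perm (Fin j)) (σ : Equiv.Perm (Fin N)) : ℝ :=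
  (coc π σ : ℝ) / N

/-- Permutations of arbitrary finite size. -/
abbrev AnyPerm : Type := Σ N : ℕ, Equiv.Perm (Fin N)

/-- The set of `B`-avoiding permutations of size `N`. -/
def AvN (B : Set AnyPerm) (N : ℕ) : Set (Equiv.Perm (Fin N)) :=
  {σ | ∀ π ∈ B, ¬ Contains σ π.2}

/-- The class of `B`-avoiding permutations of arbitrary size `N ≥ 1`. -/
def Av (B : Set AnyPerm) : Set AnyPerm :=
  {σ | 1 ≤ σ.1 ∧ σ.2 ∈ AvN B σ.1}

theorem pat_mem_AvN {B : Set AnyPerm} {j N : ℕ} {σ : Equiv.Perm (Fin N)} (hσ : σ ∈ AvN B N)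
    (I : Fin j ↪o Fin N) : pat I σ ∈ AvN B j := by
  rintro π hπ ⟨J, hJ⟩
  exact hσ π hπ ⟨J.trans I, by rw [← hJ, pat_pat]⟩

/-- The pattern-avoiding feasible region for consecutive patterns of size `k` for `Av(B)`. -/
def feasibleRegion (B : Set AnyPerm) (k : ℕ) : Set (Equiv.Perm (Fin k) → ℝ) :=
  {v | (∀ π, v π ∈ Set.Icc (0 : ℝ) 1) ∧
    ∃ σ : ℕ → AnyPerm, (∀ m, σ m ∈ Av B) ∧ Tendsto (fun m => (σ m).1) atTop atTop ∧
      ∀ π : Equiv.Perm (Fin k), Tendsto (fun m => cocDensity π (σ m).2) atTop (𝓝 (v π))}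

/-- The decreasing pattern `n ⋯ 1`, as a one-element set of patterns. -/
def decr (n : ℕ) : Set AnyPerm := {⟨n, Fin.revPerm⟩}

/-! ### Directed multigraphs and their cycle polytopes -/

/-- A directed multigraph with vertex set `V` and edge set `E`. -/
structure DiMultigraph (V E : Type*) where
  st : E → V
  ar : E → V

namespace DiMultigraph

variable {V E : Type*}

/-- A walk: a sequence of edges, each arriving where the next one starts. -/
def IsWalk (G : DiMultigraph V E) (w : List E) : Prop :=
  w.IsChain fun e f => G.ar e = G.st f

/-- A non-empty walk whose first edge starts where its last edge arrives. -/
def IsCycle (G : DiMultigraph V E) (w : List E) : Prop :=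
  G.IsWalk w ∧ ∃ h : w ≠ [], G.st (w.head h) = G.ar (w.getLast h)

/-- A walk with distinct edges and with distinct vertices, except that the first vertex may
coincide with the last one. If the walk visits `v_0, …, v_m`, the two lists of vertices below are
`v_0, …, v_{m-1}` and `v_1, …, v_m`: every pair of positions but `(0, m)` lies in one of them. -/
def IsPath (G : DiMultigraph V E) (w : List E) : Prop :=
  G.IsWalk w ∧ w.Nodup ∧ (w.map G.st).Nodup ∧ (w.map G.ar).Nodup

def IsSimpleCycle (G : DiMultigraph V E) (w : List E) : Prop :=
  G.IsCycle w ∧ G.IsPath w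

/-- The vector of the proportions of occurrences of each edge in `w`. -/
noncomputable def edgeVector [DecidableEq E] (w : List E) : E → ℝ :=
  fun e => (w.count e : ℝ) / w.length

/-- The cycle polytope. -/
def cyclePolytope [DecidableEq E] (G : DiMultigraph V E) : Set (E → ℝ) :=
  convexHull ℝ {x | ∃ w : List E, G.IsSimpleCycle w ∧ x = edgeVector w}

end DiMultigraph

/-! ### Colourings -/

/-- The right-top monotone (RITMO) colouring. Values are treated from the highest to the lowest,
and each index `i` receives the lowest colour `c ≥ 1` that creates no monochromatic `21` with an
already coloured index `j` (that is, with `j < i` and `σ j > σ i`). -/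
noncomputable def ritmo {N : ℕ} (σ : Equiv.Perm (Fin N)) (i : Fin N) : ℕ :=
  sInf {c : ℕ | 1 ≤ c ∧ ∀ j : Fin N, ∀ _ : j < i, ∀ _ : σ i < σ j, ritmo σ j ≠ c}
termination_by N - (σ i : ℕ)
decreasing_by
  have := (σ j).isLt
  simp only [Fin.lt_def] at *
  omega

/-- The colours `1, …, m`. -/
abbrev Colour (m : ℕ) : Type := Set.Icc (1 : ℕ) m

/-- A permutation of size `k` together with an `m`-colouring of its indices. -/
abbrev ColouredPerm (m k : ℕ) : Type := Equiv.Perm (Fin k) × (Fin k → Colour m)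

/-- Restriction of a coloured permutation to a set of indices. -/
def cpat {m j k : ℕ} (I : Fin j ↪o Fin k) (x : ColouredPerm m k) : ColouredPerm m j :=
  (pat I x.1, fun a => x.2 (I a))

/-- The set `C_m(k)`, for the decreasing pattern of size `n`: the pairs of a permutation of size
`k` that avoids `n ⋯ 1` and an inherited `m`-colouring of it. Inherited means that the pair is
the restriction, to the last `k` indices, of some permutation of size `ℓ ≥ k` that avoids
`n ⋯ 1`, coloured with its RITMO colouring. -/
def inherited (n m k : ℕ) : Set (ColouredPerm m k) :=
  {x | x.1 ∈ AvN (decr n) k ∧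
    ∃ (ℓ : ℕ) (h : k ≤ ℓ) (σ : Equiv.Perm (Fin ℓ)), σ ∈ AvN (decr n) ℓ ∧
      pat (lastIdx h) σ = x.1 ∧ ∀ a, ritmo σ (lastIdx h a) = x.2 a}

theorem ritmo_pat_firstIdx {j N : ℕ} (h : j ≤ N) (σ : Equiv.Perm (Fin N)) (i : Fin j) :
    ritmo (pat (firstIdx h) σ) i = ritmo σ (firstIdx h i) := by
  induction i using WellFoundedLT.induction with
  | ind i ih =>
    rw [ritmo, ritmo]
    congr 1
    ext c
    refine and_congr_right fun _ => ⟨fun H b hb hσ => ?_, fun H b hb hσ => ?_⟩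
    · have hbj : (b : ℕ) < j := by
        have : (b : ℕ) < firstIdx h i := hb
        rw [firstIdx_val] at this
        omega
      have hbe : firstIdx h ⟨b, hbj⟩ = b := by
        ext; simp [firstIdx_val]
      have hlt : (⟨b, hbj⟩ : Fin j) < i := (firstIdx h).lt_iff_lt.1 (by rwa [hbe])
      have := H ⟨b, hbj⟩ hlt ((pat_lt_pat_iff _ _ _ _).2 (by rwa [hbe]))
      rwa [ih _ hlt, hbe] at this
    · rw [ih b hb]
      exact H _ ((firstIdx h).lt_iff_lt.2 hb) ((pat_lt_pat_iff _ _ _ _).1 hσ)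

theorem cpat_lastIdx_mem {n m k j : ℕ} (hj : j ≤ k) {x : ColouredPerm m k}
    (hx : x ∈ inherited n m k) : cpat (lastIdx hj) x ∈ inherited n m j := by
  obtain ⟨hav, ℓ, h, σ, hσ, hp, hc⟩ := hx
  have he : (lastIdx hj).trans (lastIdx h) = lastIdx (hj.trans h) := by
    ext a
    simp only [RelEmbedding.coe_trans, Function.comp_apply, lastIdx_val]
    omega
  refine ⟨pat_mem_AvN hav _, ℓ, hj.trans h, σ, hσ, ?_, fun a => ?_⟩
  · simp only [cpat]
    rw [← hp, pat_pat, he]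
  · simp only [cpat]
    rw [← hc, ← he]
    rfl

theorem cpat_firstIdx_mem {n m k j : ℕ} (hj : j ≤ k) {x : ColouredPerm m k}
    (hx : x ∈ inherited n m k) : cpat (firstIdx hj) x ∈ inherited n m j := by
  obtain ⟨hav, ℓ, h, σ, hσ, hp, hc⟩ := hx
  have h1 : ℓ - (k - j) ≤ ℓ := by omega
  have h2 : j ≤ ℓ - (k - j) := by omega
  have he : (lastIdx h2).trans (firstIdx h1) = (firstIdx hj).trans (lastIdx h) := by
    ext a
    simp only [RelEmbedding.coe_trans, Function.comp_apply, lastIdx_val, firstIdx_val]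
    omega
  refine ⟨pat_mem_AvN hav _, ℓ - (k - j), h2, pat (firstIdx h1) σ, pat_mem_AvN hσ _, ?_,
    fun a => ?_⟩
  · simp only [cpat]
    rw [← hp, pat_pat, pat_pat, he]
  · simp only [cpat]
    rw [← hc, ritmo_pat_firstIdx]
    exact congrArg (ritmo σ) (DFunLike.congr_fun he a)

/-- The coloured overlap graph of the decreasing pattern of size `n`: an edge is an inherited
`(n-1)`-coloured permutation of size `k`; it goes from its restriction to the first `k-1` indices
to its restriction to the last `k-1` indices. -/
def colouredOverlapGraph (n k : ℕ) :
    DiMultigraph (inherited n (n - 1) (k - 1)) (inherited n (n - 1) k) where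
  st x := ⟨cpat (firstIdx (Nat.sub_le k 1)) x.1, cpat_firstIdx_mem _ x.2⟩
  ar x := ⟨cpat (lastIdx (Nat.sub_le k 1)) x.1, cpat_lastIdx_mem _ x.2⟩

/-- The linear map `Π` that forgets the colourings: it sends the basis vector of `(π, c)` to the
basis vector of `π`. -/
noncomputable def forgetColours (n k : ℕ) :
    (inherited n (n - 1) k → ℝ) →ₗ[ℝ] (AvN (decr n) k → ℝ) :=
  (Pi.basisFun ℝ (inherited n (n - 1) k)).constr ℝ fun x => Pi.single ⟨x.1.1, x.2.1⟩ 1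

theorem forgetColours_single (n k : ℕ) (x : inherited n (n - 1) k) :
    forgetColours n k (Pi.single x 1) = Pi.single ⟨x.1.1, x.2.1⟩ 1 := by
  have h := (Pi.basisFun ℝ (inherited n (n - 1) k)).constr_basis ℝ
    (fun x => (Pi.single ⟨x.1.1, x.2.1⟩ 1 : AvN (decr n) k → ℝ)) x
  rwa [Pi.basisFun_apply] at h

/-- The inclusion of `ℝ^{Av_k(B)}` in `ℝ^{S_k}`: the new coordinates are zero. -/
noncomputable def inclusion (B : Set AnyPerm) (k : ℕ) :
    (AvN B k → ℝ) →ₗ[ℝ] (Equiv.Perm (Fin k) → ℝ) :=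
  Function.ExtendByZero.linearMap ℝ Subtype.val

end ConsecutivePatterns

open ConsecutivePatterns

namespace ConsecutivePatterns

/-! ### Extracting simple cycles from walks -/

namespace DiMultigraph

variable {V E : Type*} {G : DiMultigraph V E}

theorem IsWalk.cons_st_map_ar {e : E} {s : List E} (h : G.IsWalk (e :: s)) :
    G.st e :: (e :: s).map G.ar =
      (e :: s).map G.st ++ [G.ar ((e :: s).getLast (List.cons_ne_nil e s))] := by
  induction s generalizing e with
  | nil => simp
  | cons f s ih =>
    have h' := List.isChain_cons_cons.1 h
    have := ih h'.2
    simp only [List.map_cons, List.cons_append, List.cons.injEq, true_and,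
      List.getLast_cons_cons] at this ⊢
    exact ⟨h'.1, this⟩

/-- In a closed walk the arrival vertices are a rotation of the starting vertices, so distinct
starts give distinct arrivals, and also distinct edges. -/
theorem IsCycle.isSimpleCycle {w : List E} (h : G.IsCycle w) (hst : (w.map G.st).Nodup) :
    G.IsSimpleCycle w := by
  refine ⟨h, h.1, hst.of_map, hst, ?_⟩
  obtain ⟨hw, hne, hcl⟩ := h
  obtain ⟨e, s, rfl⟩ := List.exists_cons_of_ne_nil hne
  have := hw.cons_st_map_ar
  rw [← hcl, List.head_cons] at this
  have hp : List.Perm ((e :: s).map G.ar) ((e :: s).map G.st) := by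
    refine (List.perm_cons (G.st e)).1 ?_
    rw [this]
    exact List.perm_append_singleton _ _
  exact hp.nodup_iff.2 hst

/-- Reading from the right, the first start that repeats a later one opens a simple loop, because
the starts after it are still distinct. The last conclusion feeds the induction: when nothing
precedes the loop, it lets an earlier edge be joined to what follows. -/
theorem IsWalk.exists_simpleCycle {w : List E} (hw : G.IsWalk w) (hst : ¬(w.map G.st).Nodup) :
    ∃ a c b : List E, w = a ++ c ++ b ∧ G.IsSimpleCycle c ∧ G.IsWalk (a ++ b) ∧
      ∃ (hc : c ≠ []) (hb : b ≠ []), G.st (b.head hb) = G.st (c.head hc) := by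
  induction w with
  | nil => simp at hst
  | cons e w ih =>
    have hw' : G.IsWalk w := List.IsChain.tail hw
    by_cases hn : (w.map G.st).Nodup
    · have he : G.st e ∈ w.map G.st := by
        by_contra h
        exact hst (by simpa using ⟨by simpa using h, hn⟩)
      obtain ⟨f, hf, hfe⟩ := List.mem_map.1 he
      obtain ⟨s, b, rfl⟩ := List.append_of_mem hf
      have hsplit := List.isChain_append.1 (show List.IsChain _ ((e :: s) ++ f :: b) from hw)
      refine ⟨[], e :: s, f :: b, by simp, IsCycle.isSimpleCycle
        ⟨hsplit.1, by simp, ?_⟩ ?_, hsplit.2.1, by simp, by simp, hfe⟩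
      · rw [List.head_cons, ← hfe]
        exact (hsplit.2.2 _ (List.getLast_mem_getLast? _) f (by simp)).symm
      · rw [List.map_append, List.map_cons, List.nodup_append] at hn
        rw [List.map_cons, List.nodup_cons]
        refine ⟨fun h => hn.2.2 _ h (G.st f) (by simp) hfe.symm, hn.1⟩
    · obtain ⟨a, c, b, rfl, hc, hab, hc0, hb0, hbc⟩ := ih hw' hn
      refine ⟨e :: a, c, b, by simp, hc, ?_, hc0, hb0, hbc⟩
      cases a with
      | nil =>
        obtain ⟨x, c, rfl⟩ := List.exists_cons_of_ne_nil hc0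
        obtain ⟨y, b, rfl⟩ := List.exists_cons_of_ne_nil hb0
        have h1 := (List.isChain_cons_cons.1 hw).1
        exact List.isChain_cons_cons.2 ⟨h1.trans hbc.symm, hab⟩
      | cons x a => exact List.isChain_cons_cons.2 ⟨(List.isChain_cons_cons.1 hw).1, hab⟩

/-- Up to at most `|V|` edges, a walk is covered by a point of the cycle polytope. -/
theorem IsWalk.exists_cyclePolytope_le [Finite V] [DecidableEq E] {w : List E}
    (hw : G.IsWalk w) : ∃ t : ℕ, w.length ≤ t + Nat.card V ∧
      (t = 0 ∨ ∃ y ∈ G.cyclePolytope, ∀ e, (t : ℝ) * y e ≤ w.count e) := by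
  induction hl : w.length using Nat.strong_induction_on generalizing w with
  | _ l ih =>
    by_cases hst : (w.map G.st).Nodup
    -- The case `t = 0` stands apart because the polytope of an acyclic graph is empty.
    · refine ⟨0, ?_, Or.inl rfl⟩
      have := Fintype.ofFinite V
      have := hst.length_le_card
      rw [List.length_map] at this
      rw [Nat.card_eq_fintype_card]
      omega
    · obtain ⟨a, c, b, rfl, hc, hab, hc0, -⟩ := hw.exists_simpleCycle hst
      have hcl : 0 < c.length := List.length_pos_iff.2 hc0
      have hcl' : (0 : ℝ) < c.length := by exact_mod_cast hcl
      simp only [List.length_append] at hl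
      obtain ⟨t, ht, h⟩ := ih (a ++ b).length (by simp; omega) hab rfl
      rw [List.length_append] at ht
      have hmem : edgeVector c ∈ G.cyclePolytope := subset_convexHull _ _ ⟨c, hc, rfl⟩
      have hcount : ∀ e, ((a ++ c ++ b).count e : ℝ) = (a ++ b).count e + c.count e := by
        intro e
        simp only [List.count_append]
        push_cast
        ring
      refine ⟨t + c.length, by omega, Or.inr ?_⟩
      rcases h with rfl | ⟨y, hy, hle⟩
      · refine ⟨_, hmem, fun e => ?_⟩
        rw [hcount, edgeVector]
        push_cast
        rw [zero_add, mul_div_cancel₀ _ hcl'.ne']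
        exact le_add_of_nonneg_left (by positivity)
      · have hpos : (0 : ℝ) < t + c.length := by positivity
        -- The weights are proportional to `t` and `c.length`, so that `t + c.length` times the new
        -- point is `t • y` plus the edge counts of `c`.
        refine ⟨_, (convex_convexHull ℝ _) hy hmem
          (div_nonneg t.cast_nonneg hpos.le) (div_nonneg hcl'.le hpos.le)
          (by field_simp), fun e => ?_⟩
        have := hle e
        rw [hcount]
        simp only [Pi.add_apply, Pi.smul_apply, smul_eq_mul, edgeVector]
        push_cast
        field_simp
        linarith

/-- Simple cycles repeat no edge, so there are finitely many. -/
theorem isCompact_cyclePolytope [Finite E] [DecidableEq E] : IsCompact G.cyclePolytope := by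
  refine Set.Finite.isCompact_convexHull ℝ (E := E → ℝ) ?_
  have : Fintype E := Fintype.ofFinite E
  refine ((List.finite_length_le E (Fintype.card E)).image edgeVector).subset ?_
  rintro x ⟨w, hw, rfl⟩
  exact ⟨w, hw.2.2.1.length_le_card, rfl⟩

end DiMultigraph

end ConsecutivePatterns

namespace ConsecutivePatterns

/-! ### The RITMO colouring and inherited colourings -/

section Ritmo

variable {N : ℕ} (σ : Equiv.Perm (Fin N))

theorem ritmo_spec (i : Fin N) :
    1 ≤ ritmo σ i ∧ ∀ j < i, σ i < σ j → ritmo σ j ≠ ritmo σ i := by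
  have hne : {c : ℕ | 1 ≤ c ∧ ∀ j : Fin N, ∀ _ : j < i, ∀ _ : σ i < σ j, ritmo σ j ≠ c}.Nonempty := by
    obtain ⟨M, hM⟩ := (Set.finite_range (ritmo σ)).bddAbove
    exact ⟨M + 1, by omega, fun j _ _ => (Nat.lt_succ_of_le (hM ⟨j, rfl⟩)).ne⟩
  have h := Nat.sInf_mem hne
  rw [← ritmo] at h
  exact ⟨h.1, fun j h1 h2 => h.2 j h1 h2⟩

theorem exists_ritmo_eq {i : Fin N} {c : ℕ} (h1 : 1 ≤ c) (hc : c < ritmo σ i) :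
    ∃ j < i, σ i < σ j ∧ ritmo σ j = c := by
  rw [ritmo] at hc
  have := Nat.notMem_of_lt_sInf hc
  simp only [Set.mem_ofPred_eq, not_and, not_forall, not_not] at this
  obtain ⟨j, hj, hσ, h⟩ := this h1
  exact ⟨j, hj, hσ, h⟩

/-- A colour smaller than that of `i` was refused at `i` because of an entry further left and
higher. That entry also forms an inversion with `j`, so `j` cannot take this colour either. -/
theorem ritmo_lt_ritmo {i j : Fin N} (hij : i < j) (hσ : σ j < σ i) : ritmo σ i < ritmo σ j := by
  by_contra! h
  obtain h | h := h.lt_or_eq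
  · obtain ⟨l, hl, hσl, he⟩ := exists_ritmo_eq σ (ritmo_spec σ j).1 h
    exact (ritmo_spec σ j).2 l (hl.trans hij) (hσ.trans hσl) he
  · exact (ritmo_spec σ j).2 i hij hσ h.symm

/-- Each colour above 1 is explained by an earlier, higher entry of the preceding colour; following
these entries back to colour 1 gives the subsequence. -/
theorem exists_decreasing_of_ritmo_eq (c : ℕ) (i : Fin N) (h : ritmo σ i = c + 1) :
    ∃ I : Fin (c + 1) → Fin N, StrictMono I ∧ StrictAnti (σ ∘ I) ∧ I (Fin.last c) = i := by
  induction c generalizing i with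
  | zero => exact ⟨fun _ => i, fun a b h => by omega, fun a b h => by omega, rfl⟩
  | succ c ih =>
    obtain ⟨j, hj, hσ, hr⟩ := exists_ritmo_eq σ (i := i) (c := c + 1) (by omega) (by omega)
    obtain ⟨I, hI, hA, hl⟩ := ih j hr
    refine ⟨Fin.snoc (α := fun _ => Fin N) I i, ?_, ?_, Fin.snoc_last (α := fun _ => Fin N) _ _⟩
    · rw [Fin.strictMono_iff_lt_succ]
      intro a
      induction a using Fin.lastCases with
      | last =>
        rw [Fin.succ_last, Fin.snoc_last, Fin.snoc_castSucc, hl]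
        exact hj
      | cast a =>
        rw [← Fin.castSucc_succ, Fin.snoc_castSucc, Fin.snoc_castSucc]
        exact hI Fin.castSucc_lt_succ
    · rw [Fin.strictAnti_iff_succ_lt]
      intro a
      simp only [Function.comp_apply]
      induction a using Fin.lastCases with
      | last =>
        rw [Fin.succ_last, Fin.snoc_last, Fin.snoc_castSucc, hl]
        exact hσ
      | cast a =>
        rw [← Fin.castSucc_succ, Fin.snoc_castSucc, Fin.snoc_castSucc]
        exact hA Fin.castSucc_lt_succ

variable {σ} in
theorem mem_AvN_decr_iff {n : ℕ} :
    σ ∈ AvN (decr n) N ↔ ¬∃ I : Fin n → Fin N, StrictMono I ∧ StrictAnti (σ ∘ I) := by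
  simp only [AvN, decr, Set.mem_ofPred_eq, Set.mem_singleton_iff, forall_eq]
  refine not_congr ⟨?_, ?_⟩
  · rintro ⟨I, hI⟩
    refine ⟨I, I.strictMono, fun a b hab => ?_⟩
    refine (pat_lt_pat_iff I σ b a).1 ?_
    rw [hI]
    simpa using hab
  · rintro ⟨I, hI, hA⟩
    refine ⟨OrderEmbedding.ofStrictMono I hI, perm_eq_of_lt_iff fun a b => ?_⟩
    rw [pat_lt_pat_iff]
    simpa using hA.lt_iff_gt (a := a) (b := b)

variable {σ} in
theorem ritmo_le_of_mem_AvN {n : ℕ} (hσ : σ ∈ AvN (decr n) N) (i : Fin N) :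
    ritmo σ i ≤ n - 1 := by
  by_contra! h
  have h1 := (ritmo_spec σ i).1
  obtain ⟨I, hI, hA, -⟩ := exists_decreasing_of_ritmo_eq σ (ritmo σ i - 1) i (by omega)
  have hm : StrictMono (Fin.castLE (show n ≤ ritmo σ i - 1 + 1 by omega)) :=
    Fin.strictMono_castLE _
  exact mem_AvN_decr_iff.1 hσ ⟨_, hI.comp hm, hA.comp_strictMono hm⟩

end Ritmo

/-- The only property of inherited colourings used when windows are glued together. -/
theorem lt_of_colour_le {n m k : ℕ} {x : ColouredPerm m k} (hx : x ∈ inherited n m k)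
    {a b : Fin k} (hab : a < b) (hc : (x.2 b : ℕ) ≤ x.2 a) : x.1 a < x.1 b := by
  obtain ⟨-, ℓ, h, σ, -, hp, hr⟩ := hx
  by_contra hlt
  have hba : x.1 b < x.1 a := lt_of_le_of_ne (not_lt.1 hlt) (x.1.injective.ne hab.ne')
  rw [← hp, pat_lt_pat_iff] at hba
  have := ritmo_lt_ritmo σ ((lastIdx h).lt_iff_lt.2 hab) hba
  rw [hr, hr] at this
  omega

/-- The window ends a prefix of `σ`, and the prefix keeps its RITMO colours because a colour depends
only on earlier indices. -/
theorem mem_inherited_window {n k N : ℕ} {σ : Equiv.Perm (Fin N)} (hσ : σ ∈ AvN (decr n) N)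
    {i : ℕ} (h : i + k ≤ N) :
    ((pat (window i h) σ, fun a => ⟨ritmo σ (window i h a), (ritmo_spec σ _).1,
      ritmo_le_of_mem_AvN hσ _⟩) : ColouredPerm (n - 1) k) ∈ inherited n (n - 1) k := by
  have he : (lastIdx (Nat.le_add_left k i)).trans (firstIdx h) = window i h := by
    ext a
    simp only [RelEmbedding.coe_trans, Function.comp_apply, lastIdx_val, firstIdx_val]
    change i + k - k + (a : ℕ) = i + a
    omega
  refine ⟨pat_mem_AvN hσ _, i + k, Nat.le_add_left k i, pat (firstIdx h) σ, pat_mem_AvN hσ _,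
    ?_, fun a => ?_⟩
  · rw [pat_pat, he]
  · rw [ritmo_pat_firstIdx, ← he]
    rfl

end ConsecutivePatterns

namespace ConsecutivePatterns

/-! ### Realizing colour-compatible orders by avoiding permutations -/

theorem std_eq_std {k : ℕ} {α β : Type*} [LinearOrder α] [LinearOrder β] {x : Fin k → α}
    {y : Fin k → β} (hx : Function.Injective x) (hy : Function.Injective y)
    (h : ∀ a b, x a < x b ↔ y a < y b) : std x = std y :=
  perm_eq_of_lt_iff fun a b => by rw [std_lt_std_iff hx, std_lt_std_iff hy, h]

/-- The first `N` values of `f` are distinct, and no `21` among them is monochromatic; in fact the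
colours increase along every `21`. -/
def ColourCompatible (m N : ℕ) (f : ℕ → ℚ) (c : ℕ → ℕ) : Prop :=
  (∀ i < N, c i ∈ Set.Icc 1 m) ∧ ∀ i j, i < j → j < N → f i < f j ∨ (f j < f i ∧ c i < c j)

theorem ColourCompatible.injOn {m N : ℕ} {f : ℕ → ℚ} {c : ℕ → ℕ} (h : ColourCompatible m N f c) :
    Set.InjOn f (Set.Iio N) := by
  intro i hi j hj he
  by_contra hne
  rcases Nat.lt_or_gt_of_ne hne with hij | hij
  · rcases h.2 i j hij hj with h | h
    · exact h.ne he
    · exact h.1.ne he.symm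
  · rcases h.2 j i hij hi with h | h
    · exact h.ne he.symm
    · exact h.1.ne he

theorem ColourCompatible.injective_window {m N : ℕ} {f : ℕ → ℚ} {c : ℕ → ℕ}
    (h : ColourCompatible m N f c) {i k : ℕ} (hi : i + k ≤ N) :
    Function.Injective fun a : Fin k => f (i + a) := by
  intro a b hab
  have := h.injOn (show i + (a : ℕ) < N by omega) (show i + (b : ℕ) < N by omega) hab
  ext
  omega

/-- Colours strictly increase along a decreasing subsequence, and n - 1 of them cannot serve n
entries. -/
theorem ColourCompatible.std_mem {n N : ℕ} {f : ℕ → ℚ} {c : ℕ → ℕ} (hn : 1 ≤ n)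
    (h : ColourCompatible (n - 1) N f c) : std (fun a : Fin N => f a) ∈ AvN (decr n) N := by
  have hinj : Function.Injective fun a : Fin N => f a := by
    simpa using h.injective_window (i := 0) (k := N) (by omega)
  rw [mem_AvN_decr_iff]
  rintro ⟨I, hI, hA⟩
  have hc : StrictMono fun a => c (I a) := by
    intro a b hab
    have h1 : f (I b) < f (I a) := (std_lt_std_iff hinj _ _).1 (hA hab)
    rcases h.2 (I a) (I b) (hI hab) (I b).isLt with h2 | h2
    · exact absurd h2 h1.not_gt
    · exact h2.2
  have hcard := Finset.card_le_card_of_injOn (s := (Finset.univ : Finset (Fin n)))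
    (t := Finset.Icc 1 (n - 1)) (fun a => c (I a))
    (fun a _ => by simpa using h.1 (I a) (I a).isLt) hc.injective.injOn
  simp at hcard
  omega

/-- The number of windows of length `k` among the first `N` values of `f` with pattern `π`. -/
def windowCount {k : ℕ} (N : ℕ) (f : ℕ → ℚ) (π : Equiv.Perm (Fin k)) : ℕ :=
  Nat.count (fun i => i + k ≤ N ∧ std (fun a : Fin k => f (i + a)) = π) N

open Classical in
theorem coc_eq_count {j N : ℕ} (π : Equiv.Perm (Fin j)) (σ : Equiv.Perm (Fin N)) :
    coc π σ = Nat.count (fun i => ∃ h : i + j ≤ N, pat (window i h) σ = π) N := by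
  rw [coc, Nat.card_eq_fintype_card, Fintype.card_subtype, Nat.count_eq_card_filter_range]
  refine Finset.card_bij (fun i _ => i) (fun i hi => ?_) (fun i _ j _ h => Fin.ext h)
    fun i hi => ?_
  · simpa using hi
  · simp only [Finset.mem_filter, Finset.mem_range] at hi
    exact ⟨⟨i, hi.1⟩, by simpa using hi.2, rfl⟩

theorem ColourCompatible.windowCount_le_coc {m N k : ℕ} {f : ℕ → ℚ} {c : ℕ → ℕ}
    (h : ColourCompatible m N f c) (π : Equiv.Perm (Fin k)) :
    windowCount N f π ≤ coc π (std fun a : Fin N => f a) := by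
  classical
  rw [coc_eq_count, windowCount]
  have hinj : Function.Injective fun a : Fin N => f a := by
    simpa using h.injective_window (i := 0) (k := N) (by omega)
  refine Nat.count_mono_left fun i _ ⟨hi, hp⟩ => ⟨hi, ?_⟩
  rw [← hp]
  refine perm_eq_of_lt_iff fun a b => ?_
  rw [pat_lt_pat_iff, std_lt_std_iff hinj, std_lt_std_iff (h.injective_window hi)]
  rfl

/-- Colour-compatible sequences can be concatenated, the second one above the first one. -/
theorem ColourCompatible.exists_concat {m N₁ N₂ : ℕ} {f₁ f₂ : ℕ → ℚ} {c₁ c₂ : ℕ → ℕ}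
    (h₁ : ColourCompatible m N₁ f₁ c₁) (h₂ : ColourCompatible m N₂ f₂ c₂) (k : ℕ) :
    ∃ f c, ColourCompatible m (N₁ + N₂) f c ∧ ∀ π : Equiv.Perm (Fin k),
      windowCount N₁ f₁ π + windowCount N₂ f₂ π ≤ windowCount (N₁ + N₂) f π := by
  obtain ⟨M, hM⟩ : ∃ M : ℚ, ∀ i < N₁, ∀ j < N₂, f₁ i < f₂ j + M := by
    obtain ⟨B, hB⟩ := (Set.Finite.image2 (fun i j => f₁ i - f₂ j) (Set.finite_Iio N₁)
      (Set.finite_Iio N₂)).bddAbove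
    refine ⟨B + 1, fun i hi j hj => ?_⟩
    have := hB (Set.mem_image2_of_mem (f := fun i j => f₁ i - f₂ j) hi hj)
    linarith
  let f : ℕ → ℚ := fun i => if i < N₁ then f₁ i else f₂ (i - N₁) + M
  let c : ℕ → ℕ := fun i => if i < N₁ then c₁ i else c₂ (i - N₁)
  have hf₁ : ∀ i < N₁, f i = f₁ i := fun i hi => if_pos hi
  have hf₂ : ∀ i, f (N₁ + i) = f₂ i + M := fun i => by simp [f]
  have hc₁ : ∀ i < N₁, c i = c₁ i := fun i hi => if_pos hi
  have hc₂ : ∀ i, c (N₁ + i) = c₂ i := fun i => by simp [c]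
  have hfc : ColourCompatible m (N₁ + N₂) f c := by
    refine ⟨fun i hi => ?_, fun i j hij hj => ?_⟩
    · rcases lt_or_ge i N₁ with h | h
      · rw [hc₁ i h]
        exact h₁.1 i h
      · obtain ⟨i, rfl⟩ := Nat.exists_eq_add_of_le h
        rw [hc₂]
        exact h₂.1 i (by omega)
    · rcases lt_or_ge j N₁ with h | h
      · rw [hc₁ j h, hc₁ i (hij.trans h), hf₁ j h, hf₁ i (hij.trans h)]
        exact h₁.2 i j hij h
      · obtain ⟨j, rfl⟩ := Nat.exists_eq_add_of_le h
        rcases lt_or_ge i N₁ with h' | h'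
        · rw [hf₁ i h', hf₂]
          exact Or.inl (hM i h' j (by omega))
        · obtain ⟨i, rfl⟩ := Nat.exists_eq_add_of_le h'
          rw [hf₂, hf₂, hc₂, hc₂, add_lt_add_iff_right, add_lt_add_iff_right]
          exact h₂.2 i j (by omega) (by omega)
  refine ⟨f, c, hfc, fun π => ?_⟩
  simp only [windowCount]
  -- Windows straddling the junction are dropped, hence only an inequality.
  rw [Nat.count_add]
  refine add_le_add (Nat.count_mono_left fun i _ ⟨hi, hp⟩ => ⟨by omega, ?_⟩)
    (Nat.count_mono_left fun i _ ⟨hi, hp⟩ => ⟨by omega, ?_⟩)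
  · rw [← hp]
    congr 1
    ext a
    exact hf₁ _ (by omega)
  · rw [← hp]
    refine std_eq_std (hfc.injective_window (by omega)) (h₂.injective_window hi) fun a b => ?_
    rw [add_assoc, add_assoc, hf₂, hf₂, add_lt_add_iff_right]

/-- A comparison of the indices at distance less than `k`, transitive within each window and
compatible with colours, is induced by a colour-compatible sequence. -/
theorem exists_realization {k : ℕ} {R : ℕ → ℕ → Prop} {c : ℕ → ℕ}
    (hc : ∀ i j, i < j → j < i + k → c j ≤ c i → R i j)
    (ht : ∀ i j l, i < j → j < l → l < i + k → R i j → R j l → R i l)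
    (ht' : ∀ i j l, i < j → j < l → l < i + k → ¬R i j → ¬R j l → ¬R i l) (N : ℕ) :
    ∃ f : ℕ → ℚ, (∀ i j, i < j → j < N → f i < f j ∨ (f j < f i ∧ c i < c j)) ∧
      ∀ i j, i < j → j < N → j < i + k → (f i < f j ↔ R i j) := by
  induction N with
  | zero => exact ⟨0, by simp, by simp⟩
  | succ N ih =>
    obtain ⟨f, hf, hR⟩ := ih
    have hnot : ∀ i j, i < j → j < N → ¬f i < f j → f j < f i := fun i j hij hj h =>
      ((hf i j hij hj).resolve_left h).1
    -- `P` selects the entries below everything that must lie above the new entry `N`. These form a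
    -- lower set of values, and the new value goes between it and its complement.
    let P : ℕ → Prop := fun w => ∀ u < N, N < u + k → ¬R u N → f w < f u
    have hP : ∀ w < N, N < w + k → R w N → P w := by
      intro w hw hwk hwN u hu huk huN
      rcases lt_trichotomy w u with h | rfl | h
      · refine (hR w u h hu (by omega)).2 ?_
        by_contra hwu
        exact ht' w u N h hu hwk hwu huN hwN
      · exact absurd hwN huN
      · refine hnot u w h hw fun hlt => huN ?_
        exact ht u w N h hw huk ((hR u w h hw (by omega)).1 hlt) hwN
    -- Hence every entry that ends up above the new one has a smaller colour, including those too
    -- far left for `R` to constrain directly.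
    have hPc : ∀ w < N, c N ≤ c w → P w := by
      intro w hw hcw u hu huk huN
      rcases lt_or_ge w u with h | h
      · have hcu : c u < c N := by
          by_contra! h'
          exact huN (hc u N hu huk h')
        exact (hf w u h hu).resolve_right fun h' => by omega
      · exact hP w hw (by omega) (hc w N hw (by omega) hcw) u hu huk huN
    classical
    obtain ⟨y, hy, hy'⟩ := Order.exists_between_finsets
      (((Finset.range N).filter P).image f) (((Finset.range N).filter fun w => ¬P w).image f) (by
        simp only [Finset.mem_image, Finset.mem_filter, Finset.mem_range]
        rintro _ ⟨w, ⟨hw, hPw⟩, rfl⟩ _ ⟨u, ⟨hu, hPu⟩, rfl⟩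
        simp only [P, not_forall, not_lt] at hPu
        obtain ⟨z, hz, hzk, hzN, hle⟩ := hPu
        exact (hPw z hz hzk hzN).trans_le hle)
    simp only [Finset.mem_image, Finset.mem_filter, Finset.mem_range, forall_exists_index,
      and_imp] at hy hy'
    have hlo : ∀ w < N, P w → f w < y := fun w hw h => hy _ w hw h rfl
    have hhi : ∀ w < N, ¬P w → y < f w := fun w hw h => hy' _ w hw h rfl
    have hu : ∀ i < N, Function.update f N y i = f i := fun i hi =>
      Function.update_of_ne hi.ne _ _
    refine ⟨Function.update f N y, fun i j hij hj => ?_, fun i j hij hj hjk => ?_⟩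
    · rcases Nat.lt_succ_iff_lt_or_eq.1 hj with hj | rfl
      · rw [hu j hj, hu i (hij.trans hj)]
        exact hf i j hij hj
      · rw [hu i hij, Function.update_self]
        by_cases h : P i
        · exact Or.inl (hlo i hij h)
        · refine Or.inr ⟨hhi i hij h, ?_⟩
          by_contra! h'
          exact h (hPc i hij h')
    · rcases Nat.lt_succ_iff_lt_or_eq.1 hj with hj | rfl
      · rw [hu j hj, hu i (hij.trans hj)]
        exact hR i j hij hj hjk
      · rw [hu i hij, Function.update_self]
        refine ⟨fun h => ?_, fun h => hlo i hij (hP i hij hjk h)⟩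
        by_contra hn
        exact (hhi i hij fun h' => (h' i hij hjk hn).false).not_gt h

end ConsecutivePatterns

namespace ConsecutivePatterns

/-! ### Points of the cycle polytope are feasible -/

theorem inclusion_forgetColours_apply (n k : ℕ) [Fintype (inherited n (n - 1) k)]
    (y : inherited n (n - 1) k → ℝ) (π : Equiv.Perm (Fin k)) :
    inclusion (decr n) k (forgetColours n k y) π = ∑ x, if x.1.1 = π then y x else 0 := by
  change Function.extend Subtype.val (forgetColours n k y) 0 π = _
  by_cases h : π ∈ AvN (decr n) k
  · have := Subtype.val_injective.extend_apply (forgetColours n k y) 0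
      (⟨π, h⟩ : AvN (decr n) k)
    rw [this, forgetColours, Module.Basis.constr_apply_fintype, Finset.sum_apply]
    refine Finset.sum_congr rfl fun x _ => ?_
    simp only [Pi.basisFun_equivFun, LinearEquiv.refl_apply, Pi.smul_apply, smul_eq_mul,
      Pi.single_apply, mul_ite, mul_one, mul_zero, Subtype.mk.injEq, eq_comm (a := π)]
  · rw [Function.extend_apply' _ _ _ fun ⟨a, ha⟩ => h (ha ▸ a.2)]
    refine (Finset.sum_eq_zero fun x _ => if_neg ?_).symm
    rintro rfl
    exact h x.2.1

theorem sum_count_eq_countP {E : Type*} [Fintype E] [DecidableEq E] (p : E → Prop)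
    [DecidablePred p] (w : List E) : ∑ x, (if p x then w.count x else 0) = w.countP p := by
  induction w with
  | nil => simp
  | cons e w ih =>
    rw [List.countP_cons, ← ih, ← Finset.sum_filter, ← Finset.sum_filter]
    simp only [List.count_cons, Finset.sum_add_distrib]
    simp

theorem inclusion_forgetColours_edgeVector (n k : ℕ) (w : List (inherited n (n - 1) k))
    (π : Equiv.Perm (Fin k)) :
    inclusion (decr n) k (forgetColours n k (DiMultigraph.edgeVector w)) π =
      (w.countP fun x => x.1.1 = π : ℕ) / (w.length : ℝ) := by
  have := Fintype.ofFinite (inherited n (n - 1) k)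
  rw [inclusion_forgetColours_apply, ← sum_count_eq_countP, Nat.cast_sum, Finset.sum_div]
  refine Finset.sum_congr rfl fun x _ => ?_
  split_ifs <;> simp [DiMultigraph.edgeVector]

theorem cyclePolytope_subset_stdSimplex {V E : Type*} [Fintype E] [DecidableEq E]
    (G : DiMultigraph V E) : G.cyclePolytope ⊆ stdSimplex ℝ E := by
  refine convexHull_min ?_ (convex_stdSimplex ℝ E)
  rintro _ ⟨w, hw, rfl⟩
  refine ⟨fun e => by unfold DiMultigraph.edgeVector; positivity, ?_⟩
  have hl : (w.length : ℝ) ≠ 0 := by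
    obtain ⟨h, -⟩ := hw.1.2
    exact_mod_cast (List.length_pos_iff.2 h).ne'
  have h := sum_count_eq_countP (fun _ : E => True) w
  simp only [if_true, decide_true, List.countP_true] at h
  simp only [DiMultigraph.edgeVector]
  rw [← Finset.sum_div, ← Nat.cast_sum, h, div_self hl]

theorem inclusion_forgetColours_mem_stdSimplex {n k : ℕ} [Fintype (inherited n (n - 1) k)]
    {y : inherited n (n - 1) k → ℝ} (hy : y ∈ stdSimplex ℝ (inherited n (n - 1) k)) :
    inclusion (decr n) k (forgetColours n k y) ∈ stdSimplex ℝ (Equiv.Perm (Fin k)) := by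
  simp only [stdSimplex, Set.mem_ofPred_eq, inclusion_forgetColours_apply] at hy ⊢
  refine ⟨fun π => Finset.sum_nonneg fun x _ => ?_, ?_⟩
  · split_ifs
    exacts [hy.1 x, le_rfl]
  · rw [Finset.sum_comm]
    simpa using hy.2

/-- The vectors of frequencies that are realized, up to a bounded error in the number of
windows, by colour-compatible sequences of all lengths. -/
def realizable (m k : ℕ) : Set (Equiv.Perm (Fin k) → ℝ) :=
  {v | v ∈ stdSimplex ℝ (Equiv.Perm (Fin k)) ∧ ∃ K : ℝ, ∀ N : ℕ, ∃ f c,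
    ColourCompatible m N f c ∧ ∀ π, (N : ℝ) * v π - K ≤ windowCount N f π}

theorem convex_realizable (m k : ℕ) : Convex ℝ (realizable m k) := by
  rintro v ⟨hv, K₁, h₁⟩ w ⟨hw, K₂, h₂⟩ a b ha hb hab
  -- The extra 1 pays for rounding `a * N` down; the complementary length is at least `b * N`.
  refine ⟨convex_stdSimplex ℝ _ hv hw ha hb hab, K₁ + K₂ + 1, fun N => ?_⟩
  have ha1 : a ≤ 1 := by linarith
  have hfl : ⌊a * N⌋₊ ≤ N := by
    refine Nat.floor_le_of_le ?_
    exact mul_le_of_le_one_left N.cast_nonneg ha1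
  obtain ⟨N₂, hN₂⟩ := Nat.exists_eq_add_of_le hfl
  set N₁ := ⌊a * N⌋₊ with hN₁
  have hle : (N₁ : ℝ) ≤ a * N := Nat.floor_le (by positivity)
  have hlt : a * N < N₁ + 1 := Nat.lt_floor_add_one _
  have hN : (N : ℝ) = N₁ + N₂ := by exact_mod_cast hN₂
  obtain ⟨f₁, c₁, hf₁, hw₁⟩ := h₁ N₁
  obtain ⟨f₂, c₂, hf₂, hw₂⟩ := h₂ N₂
  obtain ⟨f, c, hf, hfw⟩ := hf₁.exists_concat hf₂ k
  rw [← hN₂] at hf hfw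
  refine ⟨f, c, hf, fun π => ?_⟩
  have e1 := hw₁ π
  have e2 := hw₂ π
  have e3 : (windowCount N₁ f₁ π : ℝ) + windowCount N₂ f₂ π ≤ windowCount N f π := by
    exact_mod_cast hfw π
  have hv0 := hv.1 π
  have hw0 := hw.1 π
  have hv1 : v π ≤ 1 := (mem_Icc_of_mem_stdSimplex hv π).2
  have hb2 : b * N ≤ N₂ := by
    have : b * N = N - a * N := by rw [← eq_sub_iff_add_eq'] at hab; rw [hab]; ring
    linarith
  have e4 : (a * N - 1) * v π ≤ N₁ * v π := mul_le_mul_of_nonneg_right (by linarith) hv0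
  have e5 : b * N * w π ≤ N₂ * w π := mul_le_mul_of_nonneg_right hb2 hw0
  simp only [Pi.add_apply, Pi.smul_apply, smul_eq_mul]
  linarith

/-! ### Lower bounds on frequencies determine the limit. -/

theorem sum_coc_le {N k : ℕ} (σ : Equiv.Perm (Fin N)) :
    ∑ π : Equiv.Perm (Fin k), coc π σ ≤ N := by
  classical
  simp only [coc_eq_count, Nat.count_eq_card_filter_range]
  rw [← Finset.card_biUnion]
  · refine (Finset.card_le_card (Finset.biUnion_subset.2 fun π _ =>
      Finset.filter_subset _ _)).trans (Finset.card_range N).le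
  · intro π _ π' _ hne
    refine Finset.disjoint_filter.2 fun i _ ⟨h, hp⟩ ⟨h', hp'⟩ => hne (hp.symm.trans hp')

theorem sum_cocDensity_le {N k : ℕ} (σ : Equiv.Perm (Fin N)) :
    ∑ π : Equiv.Perm (Fin k), cocDensity π σ ≤ 1 := by
  simp only [cocDensity]
  rw [← Finset.sum_div, ← Nat.cast_sum]
  refine div_le_one_of_le₀ ?_ N.cast_nonneg
  exact_mod_cast sum_coc_le (k := k) σ

/-- The slacks `d j + ε - u j` are nonnegative and sum to at most `card ι * ε`, so each of them is
bounded by that. -/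
theorem abs_sub_le_of_sum_le {ι : Type*} [Fintype ι] {u d : ι → ℝ} {ε : ℝ}
    (hu : ∑ i, u i = 1) (hd : ∑ i, d i ≤ 1) (h : ∀ i, u i ≤ d i + ε) (i : ι) :
    |d i - u i| ≤ Fintype.card ι * ε := by
  have h0 : ∀ j, 0 ≤ d j + ε - u j := fun j => by linarith [h j]
  have hle := Finset.single_le_sum (f := fun j => d j + ε - u j) (fun j _ => h0 j)
    (Finset.mem_univ i)
  simp only [Finset.sum_sub_distrib, Finset.sum_add_distrib, Finset.sum_const,
    Finset.card_univ, nsmul_eq_mul] at hle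
  have hε : 0 ≤ ε := by
    have hc : (1 : ℝ) ≤ Fintype.card ι := by
      exact_mod_cast Fintype.card_pos_iff.2 ⟨i⟩
    have : 0 ≤ ∑ j, (d j + ε - u j) := Finset.sum_nonneg fun j _ => h0 j
    simp only [Finset.sum_sub_distrib, Finset.sum_add_distrib, Finset.sum_const,
      Finset.card_univ, nsmul_eq_mul] at this
    by_contra! hneg
    nlinarith
  have hc : (1 : ℝ) ≤ Fintype.card ι := by
    exact_mod_cast Fintype.card_pos_iff.2 ⟨i⟩
  rw [abs_le]
  constructor
  · nlinarith [h i]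
  · linarith

theorem realizable_subset_feasibleRegion {n : ℕ} (hn : 1 ≤ n) (k : ℕ) :
    realizable (n - 1) k ⊆ feasibleRegion (decr n) k := by
  rintro v ⟨hv, K, h⟩
  refine ⟨mem_Icc_of_mem_stdSimplex hv, ?_⟩
  choose f c hf hw using h
  -- Sizes start at 1 because `Av` excludes the empty permutation.
  refine ⟨fun m => ⟨m + 1, std fun a : Fin (m + 1) => f (m + 1) a⟩,
    fun m => ⟨Nat.le_add_left 1 m, (hf (m + 1)).std_mem hn⟩, tendsto_add_atTop_nat 1, fun π => ?_⟩
  have hlim : Tendsto (fun m : ℕ => (Fintype.card (Equiv.Perm (Fin k)) : ℝ) *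
      (K / ((m : ℝ) + 1))) atTop (𝓝 0) := by
    have := (tendsto_const_div_atTop_nhds_zero_nat K).comp (tendsto_add_atTop_nat 1)
    simpa [Function.comp_def] using this.const_mul (Fintype.card (Equiv.Perm (Fin k)) : ℝ)
  rw [tendsto_iff_dist_tendsto_zero]
  refine squeeze_zero (fun _ => dist_nonneg) (fun m => ?_) hlim
  rw [Real.dist_eq]
  refine abs_sub_le_of_sum_le hv.2 (sum_cocDensity_le _) (fun π => ?_) π
  have hpos : (0 : ℝ) < m + 1 := by positivity
  have h1 := hw (m + 1) π
  have h2 : (windowCount (m + 1) (f (m + 1)) π : ℝ) ≤ coc π (std fun a : Fin (m + 1) =>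
      f (m + 1) a) := by
    exact_mod_cast (hf (m + 1)).windowCount_le_coc π
  rw [cocDensity]
  push_cast at h1 ⊢
  rw [← add_div, le_div_iff₀ hpos]
  linarith

/-! ### Realizing periodic walks. -/

theorem mul_count_le_count_of_periodic {p : ℕ → Prop} [DecidablePred p] {L : ℕ}
    (hp : ∀ i, p (i + L) ↔ p i) (M : ℕ) : M / L * Nat.count p L ≤ Nat.count p M := by
  have h : ∀ q : ℕ, q * Nat.count p L = Nat.count p (q * L) := by
    intro q
    induction q with
    | zero => simp
    | succ q ih =>
      have hq : ∀ q i, p (q * L + i) ↔ p i := by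
        intro q i
        induction q with
        | zero => simp
        | succ q ih =>
          rw [← ih, ← hp (q * L + i)]
          congr! 1
          ring
      rw [Nat.succ_mul, Nat.succ_mul, Nat.count_add, ih]
      simp only [hq]
  rw [h]
  exact Nat.count_monotone p (Nat.div_mul_le_self M L)

variable {n k : ℕ}

/-- An infinite walk in the coloured overlap graph is realized by colour-compatible sequences. -/
theorem exists_realization_of_walk (hk : 1 ≤ k) {e : ℕ → inherited n (n - 1) k}
    (he : ∀ i, (colouredOverlapGraph n k).ar (e i) = (colouredOverlapGraph n k).st (e (i + 1)))
    (N : ℕ) : ∃ f c, ColourCompatible (n - 1) N f c ∧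
      ∀ i, i + k ≤ N → std (fun a : Fin k => f (i + a)) = (e i).1.1 := by
  have hcp : ∀ i, cpat (lastIdx (Nat.sub_le k 1)) (e i).1 =
      cpat (firstIdx (Nat.sub_le k 1)) (e (i + 1)).1 := fun i => congrArg Subtype.val (he i)
  have hl : ∀ {a : ℕ} (h : a + 1 < k), lastIdx (Nat.sub_le k 1) ⟨a, by omega⟩ = ⟨a + 1, h⟩ := by
    intro a h
    ext
    rw [lastIdx_val]
    simp only
    omega
  have hf : ∀ {a : ℕ} (h : a + 1 < k), firstIdx (Nat.sub_le k 1) ⟨a, by omega⟩ =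
      ⟨a, by omega⟩ := by
    intro a h
    ext
    rw [firstIdx_val]
  have hcol : ∀ s i a (h : a + s < k), (e (i + s)).1.2 ⟨a, by omega⟩ = (e i).1.2 ⟨a + s, h⟩ := by
    intro s
    induction s with
    | zero => intro i a h; rfl
    | succ s ih =>
      intro i a h
      have h1 := congrFun (congrArg Prod.snd (hcp (i + s))) ⟨a, by omega⟩
      simp only [cpat] at h1
      rw [hl (by omega), hf (by omega)] at h1
      rw [← add_assoc, ← h1, ih i (a + 1) (by omega)]
      exact congrArg _ (Fin.ext (show a + 1 + s = a + (s + 1) by omega))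
  have hlt : ∀ s i a b (ha : a + s < k) (hb : b + s < k),
      ((e (i + s)).1.1 ⟨a, by omega⟩ < (e (i + s)).1.1 ⟨b, by omega⟩ ↔
        (e i).1.1 ⟨a + s, ha⟩ < (e i).1.1 ⟨b + s, hb⟩) := by
    intro s
    induction s with
    | zero => intro i a b ha hb; rfl
    | succ s ih =>
      intro i a b ha hb
      have h1 : pat _ _ = pat _ _ := congrArg Prod.fst (hcp (i + s))
      have h2 := pat_lt_pat_iff (lastIdx (Nat.sub_le k 1)) (e (i + s)).1.1
        ⟨a, by omega⟩ ⟨b, by omega⟩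
      rw [h1, pat_lt_pat_iff, hl (by omega), hl (by omega), hf (by omega), hf (by omega),
        ih i (a + 1) (b + 1) (by omega) (by omega)] at h2
      rw [← add_assoc, h2]
      congr! 3 <;> omega
  -- The comparison is read off the window that starts at the smaller index; by `hlt`, every window
  -- containing both indices gives the same answer.
  let R : ℕ → ℕ → Prop := fun i j =>
    ∃ h : j - i < k, (e i).1.1 ⟨0, by omega⟩ < (e i).1.1 ⟨j - i, h⟩
  have hR : ∀ i a b (hab : a < b) (hb : b < k),
      R (i + a) (i + b) ↔ (e i).1.1 ⟨a, by omega⟩ < (e i).1.1 ⟨b, hb⟩ := by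
    intro i a b hab hb
    have h1 := hlt a i 0 (b - a) (by omega) (by omega)
    simp only [zero_add, Nat.sub_add_cancel hab.le] at h1
    rw [← h1]
    simp only [R, Nat.add_sub_add_left]
    exact ⟨fun ⟨_, h⟩ => h, fun h => ⟨by omega, h⟩⟩
  let c : ℕ → ℕ := fun i => (e i).1.2 ⟨0, by omega⟩
  have hc : ∀ i a (ha : a < k), c (i + a) = (e i).1.2 ⟨a, ha⟩ := by
    intro i a ha
    have := hcol a i 0 (by omega)
    simp only [zero_add] at this
    simp only [c, this]
  have hRc : ∀ i j, i < j → j < i + k → c j ≤ c i → R i j := by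
    intro i j hij hj hcj
    obtain ⟨b, rfl⟩ := Nat.exists_eq_add_of_lt hij
    have := lt_of_colour_le (e i).2 (a := ⟨0, by omega⟩) (b := ⟨b + 1, by omega⟩)
      (Fin.mk_lt_mk.2 (by omega)) (by
        rw [← hc i (b + 1) (by omega), ← hc i 0 (by omega)]
        exact hcj)
    exact (hR i 0 (b + 1) (by omega) (by omega)).2 this
  have hRt : ∀ i j l, i < j → j < l → l < i + k → R i j → R j l → R i l := by
    intro i j l hij hjl hl h1 h2
    obtain ⟨a, rfl⟩ := Nat.exists_eq_add_of_le hij.le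
    obtain ⟨b, rfl⟩ := Nat.exists_eq_add_of_le (hij.trans hjl).le
    exact (hR i 0 b (by omega) (by omega)).2 (((hR i 0 a (by omega) (by omega)).1 h1).trans
      ((hR i a b (by omega) (by omega)).1 h2))
  have hRt' : ∀ i j l, i < j → j < l → l < i + k → ¬R i j → ¬R j l → ¬R i l := by
    intro i j l hij hjl hl h1 h2
    obtain ⟨a, rfl⟩ := Nat.exists_eq_add_of_le hij.le
    obtain ⟨b, rfl⟩ := Nat.exists_eq_add_of_le (hij.trans hjl).le
    have h3 := mt (hR i 0 a (by omega) (by omega)).2 h1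
    have h4 := mt (hR i a b (by omega) (by omega)).2 h2
    exact fun h => ((not_lt.1 h4).trans (not_lt.1 h3)).not_gt
      ((hR i 0 b (by omega) (by omega)).1 h)
  obtain ⟨f, hf1, hf2⟩ := exists_realization hRc hRt hRt' N
  have hcc : ColourCompatible (n - 1) N f c := ⟨fun i _ => ((e i).1.2 _).2, hf1⟩
  refine ⟨f, c, hcc, fun i hi => perm_eq_of_lt_iff fun a b => ?_⟩
  have hinj := hcc.injective_window hi
  have key : ∀ a b : Fin k, a < b → (f (i + a) < f (i + b) ↔ (e i).1.1 a < (e i).1.1 b) := by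
    intro a b hab
    have hab' : (a : ℕ) < b := hab
    rw [hf2 _ _ (by omega) (by omega) (by omega)]
    exact hR i a b hab b.isLt
  rw [std_lt_std_iff hinj]
  rcases lt_trichotomy a b with hab | rfl | hab
  · exact key a b hab
  · simp
  · have h1 := key b a hab
    have hne := hinj.ne hab.ne'
    have hne' := (e i).1.1.injective.ne hab.ne'
    rw [← not_iff_not, not_lt, not_lt, hne.symm.le_iff_lt, hne'.symm.le_iff_lt]
    exact h1

theorem inclusion_forgetColours_edgeVector_mem_realizable (hk : 1 ≤ k)
    {w : List (inherited n (n - 1) k)} (hw : (colouredOverlapGraph n k).IsSimpleCycle w) :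
    inclusion (decr n) k (forgetColours n k (DiMultigraph.edgeVector w)) ∈
      realizable (n - 1) k := by
  have := Fintype.ofFinite (inherited n (n - 1) k)
  have hs := inclusion_forgetColours_mem_stdSimplex
    (cyclePolytope_subset_stdSimplex _ (subset_convexHull ℝ _ ⟨w, hw, rfl⟩))
  refine ⟨hs, ?_⟩
  obtain ⟨⟨hwalk, hne, hcl⟩, -⟩ := hw
  have hL : 0 < w.length := List.length_pos_iff.2 hne
  let e : ℕ → inherited n (n - 1) k := fun i => w[i % w.length]'(Nat.mod_lt i hL)
  have he : ∀ i, (colouredOverlapGraph n k).ar (e i) =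
      (colouredOverlapGraph n k).st (e (i + 1)) := by
    intro i
    have hi := Nat.mod_lt i hL
    rcases Nat.lt_or_ge (i % w.length + 1) w.length with h | h
    · have h1 := List.isChain_iff_getElem.1 hwalk (i % w.length) h
      have h2 : (i + 1) % w.length = i % w.length + 1 := by
        rw [Nat.add_mod, Nat.mod_eq_of_lt (a := 1) (by omega), Nat.mod_eq_of_lt h]
      simp only [e, h2]
      exact h1
    · have h2 : (i + 1) % w.length = 0 := by
        rw [← Nat.mod_add_mod, show i % w.length + 1 = w.length by omega, Nat.mod_self]
      have h3 : i % w.length = w.length - 1 := by omega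
      simp only [e, h2, h3]
      rw [List.head_eq_getElem, List.getLast_eq_getElem] at hcl
      exact hcl.symm
  -- The error covers the last `k` starting positions and one incomplete period.
  refine ⟨k + w.length, fun N => ?_⟩
  obtain ⟨f, c, hf, hfw⟩ := exists_realization_of_walk hk he N
  refine ⟨f, c, hf, fun π => ?_⟩
  have hv := mem_Icc_of_mem_stdSimplex hs π
  rw [inclusion_forgetColours_edgeVector] at hv ⊢
  have hcount : w.countP (fun x => x.1.1 = π) = Nat.count (fun i => (e i).1.1 = π) w.length := by
    have hmap : (List.range w.length).map e = w := by
      refine List.ext_getElem (by simp) fun i h1 h2 => ?_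
      simp only [List.getElem_map, List.getElem_range, e, Nat.mod_eq_of_lt h2]
    conv_lhs => rw [← hmap]
    rw [List.countP_map]
    rfl
  set C := w.countP fun x => x.1.1 = π
  have h1 : (N - k) / w.length * C ≤ windowCount N f π := by
    rw [hcount]
    refine (mul_count_le_count_of_periodic (fun i => ?_) (N - k)).trans ?_
    · simp only [e, Nat.add_mod_right]
    · refine le_trans (Nat.count_mono_left fun i hi hp => ?_)
        (Nat.count_monotone _ (Nat.sub_le N k))
      exact ⟨by omega, by rw [hfw i (by omega)]; exact hp⟩
  have h2 : (N : ℝ) - k ≤ ((N - k) / w.length : ℕ) * w.length + w.length := by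
    have h3 := Nat.div_add_mod (N - k) w.length
    have h4 := Nat.mod_lt (N - k) hL
    have h5 : N ≤ k + ((N - k) / w.length * w.length + w.length) := by
      rw [mul_comm] at h3
      omega
    have : (N : ℝ) ≤ k + (((N - k) / w.length : ℕ) * w.length + w.length) := by
      exact_mod_cast h5
    linarith
  have hL' : (0 : ℝ) < w.length := by exact_mod_cast hL
  have h6 : (((N - k) / w.length : ℕ) : ℝ) * C ≤ windowCount N f π := by exact_mod_cast h1
  set v : ℝ := C / w.length with hvdef
  have hC : (C : ℝ) = v * w.length := by rw [hvdef]; field_simp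
  have h7 := mul_le_mul_of_nonneg_right h2 hv.1
  have h8 : (k : ℝ) * v ≤ k := mul_le_of_le_one_right k.cast_nonneg hv.2
  have h9 : (w.length : ℝ) * v ≤ w.length := mul_le_of_le_one_right hL'.le hv.2
  rw [hC] at h6
  linarith

theorem image_cyclePolytope_subset_feasibleRegion (hn : 1 ≤ n) (hk : 1 ≤ k) :
    inclusion (decr n) k '' (forgetColours n k '' (colouredOverlapGraph n k).cyclePolytope) ⊆
      feasibleRegion (decr n) k := by
  refine subset_trans ?_ (realizable_subset_feasibleRegion hn k)
  rw [DiMultigraph.cyclePolytope, LinearMap.image_convexHull, LinearMap.image_convexHull]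
  refine convexHull_min ?_ (convex_realizable _ _)
  rintro _ ⟨_, ⟨_, ⟨w, hw, rfl⟩, rfl⟩, rfl⟩
  exact inclusion_forgetColours_edgeVector_mem_realizable hk hw

/-! ### Feasible vectors come from the cycle polytope -/

theorem exists_cyclePolytope_le_coc {N : ℕ} {σ : Equiv.Perm (Fin N)}
    (hσ : σ ∈ AvN (decr n) N) (hk : 1 ≤ k) (hkN : k ≤ N) :
    ∃ t : ℕ, N ≤ t + (k + Nat.card (inherited n (n - 1) (k - 1))) ∧
      (t = 0 ∨ ∃ y ∈ (colouredOverlapGraph n k).cyclePolytope, ∀ π,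
        (t : ℝ) * inclusion (decr n) k (forgetColours n k y) π ≤ coc π σ) := by
  have := Fintype.ofFinite (inherited n (n - 1) k)
  -- Clamping makes the edge sequence total; the walk only uses `i ≤ N - k`, where it has no effect.
  have hle : ∀ i, min i (N - k) + k ≤ N := fun i => by omega
  let e : ℕ → inherited n (n - 1) k := fun i => ⟨_, mem_inherited_window hσ (hle i)⟩
  have hw : (colouredOverlapGraph n k).IsWalk ((List.range (N - k + 1)).map e) := by
    rw [DiMultigraph.IsWalk, List.isChain_map, List.isChain_range]
    intro i hi
    have hidx : (lastIdx (Nat.sub_le k 1)).trans (window _ (hle i)) =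
        (firstIdx (Nat.sub_le k 1)).trans (window _ (hle (i + 1))) := by
      ext a
      simp only [RelEmbedding.coe_trans, Function.comp_apply]
      change min i (N - k) + (k - (k - 1) + (a : ℕ)) = min (i + 1) (N - k) + (0 + (a : ℕ))
      omega
    refine Subtype.ext (Prod.ext ?_ (funext fun a => Subtype.ext ?_))
    · change pat _ (pat _ σ) = pat _ (pat _ σ)
      rw [pat_pat, pat_pat, hidx]
    · exact congrArg (ritmo σ) (DFunLike.congr_fun hidx a)
  obtain ⟨t, ht, h⟩ := hw.exists_cyclePolytope_le
  rw [List.length_map, List.length_range] at ht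
  refine ⟨t, by omega, h.imp_right fun ⟨y, hy, hle'⟩ => ⟨y, hy, fun π => ?_⟩⟩
  have h1 : ((List.range (N - k + 1)).map e).countP (fun x => x.1.1 = π) ≤ coc π σ := by
    classical
    rw [List.countP_map, coc_eq_count]
    refine le_trans (Nat.count_mono_left (p := fun i => (e i).1.1 = π) fun i hi hp => ?_)
      (Nat.count_monotone _ (show N - k + 1 ≤ N by omega))
    have hmin : min i (N - k) = i := by omega
    refine ⟨by omega, ?_⟩
    rw [← hp]
    simp only [e, hmin]
  rw [inclusion_forgetColours_apply, Finset.mul_sum]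
  have h2 := congrArg (Nat.cast : ℕ → ℝ) (sum_count_eq_countP
    (fun x : inherited n (n - 1) k => x.1.1 = π) ((List.range (N - k + 1)).map e))
  rw [Nat.cast_sum] at h2
  refine (Finset.sum_le_sum fun x _ => ?_).trans (h2.le.trans (by exact_mod_cast h1))
  split_ifs
  · exact hle' x
  · simp

theorem feasibleRegion_subset_image_cyclePolytope (n : ℕ) (hk : 1 ≤ k) :
    feasibleRegion (decr n) k ⊆
      inclusion (decr n) k '' (forgetColours n k '' (colouredOverlapGraph n k).cyclePolytope) := by
  have := Fintype.ofFinite (inherited n (n - 1) k)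
  rintro v ⟨-, σ, hσ, hN, hlim⟩
  have hclosed : IsClosed (inclusion (decr n) k '' (forgetColours n k ''
      (colouredOverlapGraph n k).cyclePolytope)) :=
    ((DiMultigraph.isCompact_cyclePolytope.image
      (LinearMap.continuous_of_finiteDimensional _)).image
      (LinearMap.continuous_of_finiteDimensional _)).isClosed
  set D : ℕ := k + Nat.card (inherited n (n - 1) (k - 1)) with hD
  have hev : ∀ᶠ m in atTop, ∃ z : Equiv.Perm (Fin k) → ℝ,
      z ∈ inclusion (decr n) k '' (forgetColours n k ''
        (colouredOverlapGraph n k).cyclePolytope) ∧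
      ∀ π, |cocDensity π (σ m).2 - z π| ≤
        Fintype.card (Equiv.Perm (Fin k)) * ((D : ℝ) / (σ m).1) := by
    -- Beyond size `D` the degenerate case `t = 0` is impossible.
    filter_upwards [hN.eventually_gt_atTop D] with m hm
    obtain ⟨t, ht, rfl | ⟨y, hy, hle⟩⟩ :=
      exists_cyclePolytope_le_coc (hσ m).2 hk (show k ≤ (σ m).1 by omega)
    · omega
    have hz := inclusion_forgetColours_mem_stdSimplex (cyclePolytope_subset_stdSimplex _ hy)
    refine ⟨_, ⟨_, ⟨y, hy, rfl⟩, rfl⟩,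
      abs_sub_le_of_sum_le hz.2 (sum_cocDensity_le _) fun π => ?_⟩
    have hpos : (0 : ℝ) < (σ m).1 := by
      have : 0 < (σ m).1 := by omega
      exact_mod_cast this
    have ht' : ((σ m).1 : ℝ) ≤ t + D := by exact_mod_cast ht
    have hz1 := mem_Icc_of_mem_stdSimplex hz π
    rw [cocDensity, ← add_div, le_div_iff₀ hpos]
    have h1 := hle π
    have h2 := mul_le_mul_of_nonneg_right ht' hz1.1
    have h3 : (D : ℝ) * inclusion (decr n) k (forgetColours n k y) π ≤ D :=
      mul_le_of_le_one_right D.cast_nonneg hz1.2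
    linarith
  obtain ⟨z, hz⟩ := hev.choice
  -- The polytope points `z m` share the limit of the densities.
  refine hclosed.mem_of_tendsto (tendsto_pi_nhds.2 fun π => ?_) (hz.mono fun m h => h.1)
  have hε : Tendsto (fun m => (Fintype.card (Equiv.Perm (Fin k)) : ℝ) * ((D : ℝ) / (σ m).1))
      atTop (𝓝 0) := by
    have := (tendsto_const_div_atTop_nhds_zero_nat (D : ℝ)).comp hN
    simpa [Function.comp_def] using this.const_mul (Fintype.card (Equiv.Perm (Fin k)) : ℝ)
  have hdiff : Tendsto (fun m => cocDensity π (σ m).2 - z m π) atTop (𝓝 0) :=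
    squeeze_zero_norm' (hz.mono fun m h => h.2 π) hε
  simpa using (hlim π).sub hdiff

end ConsecutivePatterns

theorem theorem1p9 (n k : ℕ) (hn : 1 ≤ n) (hk : 1 ≤ k) :
    feasibleRegion (decr n) k =
      inclusion (decr n) k '' (forgetColours n k '' (colouredOverlapGraph n k).cyclePolytope) :=
  (feasibleRegion_subset_image_cyclePolytope n hk).antisymm
    (image_cyclePolytope_subset_feasibleRegion hn hk)
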